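/- Let $\alpha$ be a composition and $\lambda$ a partition (both finite sequences of positive integers, $\lambda$ weakly decreasing, possibly empty) with $\lambda\subseteq\alpha$, i.e. $\ell(\lambda)\le\ell(\alpha)$ and $\lambda_i\le\alpha_i$ for $1\le i\le\ell(\lambda)$. The skew diagram $\alpha/\lambda$ consists of the cells $(i,j)$ (row $i$ from the bottom, column $j$ from the left) with $1\le i\le \ell(\alpha)$ and $\lambda_i<j\le\alpha_i$, where $\lambda_i=0$ for $i>\ell(\lambda)$; it has $|\alpha/\lambda|=|\alpha|-|\lambda|$ cells. Assume that $\alpha/\lambda$ is nonempty, that each of its rows contains at least one cell, and that it is connected: its rows cannot be partitioned into two nonempty sets $R_1,R_2$ such that the columns occupied by the cells in the rows of $R_1$ and those occupied by the cells in the rows of $R_2$ are disjoint. The strictly advanced extended function of $\alpha/\lambda$ is the formal power series $$F_{\alpha/\lambda}=\sum_T \mathbf{x}^T\in\mathbb{Q}[[x_1,x_2,\ldots]],\qquad \mathbf{x}^T=\prod_{c\in\alpha/\lambda}x_{T(c)},$$ summed over all fillings $T$ of the cells of $\alpha/\lambda$ with positive integers such that the entries strictly increase from left to right in each row and from bottom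 to top in each column. Let $\operatorname{Sym}\subset\mathbb{Q}[[x_1,x_2,\ldots]]$ be the space of symmetric functions, the $\mathbb{Q}$-span of the monomial symmetric functions $m_\mu$ over all partitions $\mu$. Then $F_{\alpha/\lambda}$ is symmetric (lies in $\operatorname{Sym}$) if and only if $$\alpha/\lambda=(1^k,\,|\alpha/\lambda|-k)\quad\text{for some } 0\le k\le|\alpha/\lambda|-1,$$ that is, if and only if for such a $k$ the array of cells $\alpha/\lambda$ is, up to a horizontal translation, the left-justified diagram of the composition $(1,\ldots,1,|\alpha/\lambda|-k)$ with $k$ ones, row lengths listed from bottom to top. -/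

import Mathlib

noncomputable section

/-- The `i`-th part of a composition (parts are numbered from `0`), extended by `0` beyond its
length. -/
def partAt {n : ℕ} (α : Composition n) (i : ℕ) : ℕ := α.blocks.getD i 0

/-- A composition is a partition if its parts weakly decrease. -/
def IsPartition {n : ℕ} (α : Composition n) : Prop := α.blocks.Pairwise (· ≥ ·)

/-- Containment `β ⊆ α` of compositions: `ℓ(β) ≤ ℓ(α)` and `β_i ≤ α_i` for every part of `β`. -/
def CompContained {n m : ℕ} (β : Composition m) (α : Composition n) : Prop :=
  β.length ≤ α.length ∧ ∀ i < β.length, partAt β i ≤ partAt α i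

/-- The skew diagram `α / β`. The cell in row `i` from the bottom and column `j` from the left is
the pair `(i, j)`; rows and columns are numbered from `0`. -/
def skewDiagram {n m : ℕ} (α : Composition n) (β : Composition m) : Finset (ℕ × ℕ) :=
  (Finset.range α.length).biUnion fun i =>
    (Finset.Ico (partAt β i) (partAt α i)).image fun j => (i, j)

theorem mem_skewDiagram {n m : ℕ} (α : Composition n) (β : Composition m) (i j : ℕ) :
    (i, j) ∈ skewDiagram α β ↔ partAt β i ≤ j ∧ j < partAt α i := by
  simp only [skewDiagram, Finset.mem_biUnion, Finset.mem_range, Finset.mem_image, Finset.mem_Ico,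
    Prod.mk.injEq]
  constructor
  · rintro ⟨a, _, b, hb, rfl, rfl⟩
    exact hb
  · intro h
    refine ⟨i, ?_, j, h, rfl, rfl⟩
    by_contra hi
    have h0 : partAt α i = 0 := List.getD_eq_default _ _ (not_lt.mp hi)
    omega

/-- The diagram of a composition, that is, `α / ∅`. -/
def compDiagram {n : ℕ} (α : Composition n) : Finset (ℕ × ℕ) :=
  skewDiagram α (Composition.ones 0)

/-- Every row of `α / β` contains at least one cell. -/
def EveryRowNonempty {n m : ℕ} (α : Composition n) (β : Composition m) : Prop :=
  ∀ i < α.length, ∃ j, (i, j) ∈ skewDiagram α β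

/-- `α / β` is connected: its rows cannot be partitioned into two nonempty sets `R₁`, `R₂` such that
the columns occupied by the rows in `R₁` are disjoint from those occupied by the rows in `R₂`. -/
def DiagramConnected {n m : ℕ} (α : Composition n) (β : Composition m) : Prop :=
  ¬ ∃ R₁ R₂ : Finset ℕ, R₁.Nonempty ∧ R₂.Nonempty ∧ Disjoint R₁ R₂ ∧
    R₁ ∪ R₂ = Finset.range α.length ∧
    ∀ i₁ ∈ R₁, ∀ i₂ ∈ R₂, ∀ j, ¬ ((i₁, j) ∈ skewDiagram α β ∧ (i₂, j) ∈ skewDiagram α β)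

/-- A tableau of shape `D`: a filling of the cells of `D` with positive integers. -/
abbrev Tableau (D : Finset (ℕ × ℕ)) : Type := {c : ℕ × ℕ // c ∈ D} → ℕ+

/-- Entries strictly increase along rows (left to right) and along columns (bottom to top). -/
def StrictRowsCols {D : Finset (ℕ × ℕ)} (T : Tableau D) : Prop :=
  (∀ c d : {c : ℕ × ℕ // c ∈ D}, c.1.2 = d.1.2 → c.1.1 < d.1.1 → T c < T d) ∧
  (∀ c d : {c : ℕ × ℕ // c ∈ D}, c.1.1 = d.1.1 → c.1.2 < d.1.2 → T c < T d)

/-- The content of a tableau, as an exponent vector: `content T i` is the number of cells with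
entry `i`, so that `x^T` is the monomial with exponent vector `content T`. -/
def content {D : Finset (ℕ × ℕ)} (T : Tableau D) : ℕ+ →₀ ℕ := ∑ c, Finsupp.single (T c) 1

/-- Only finitely many tableaux of a given shape have a given content, so the generating function
below is a well-defined formal power series. -/
theorem finite_tableaux_content (D : Finset (ℕ × ℕ)) (d : ℕ+ →₀ ℕ) :
    {T : Tableau D | StrictRowsCols T ∧ content T = d}.Finite := by
  refine Set.Finite.subset (Set.Finite.pi' (fun _ => d.support.finite_toSet)) ?_
  rintro T ⟨_, rfl⟩ c
  rw [Finset.mem_coe, Finsupp.mem_support_iff, content, Finsupp.finsetSum_apply]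
  intro h
  have := (Finset.sum_eq_zero_iff.mp h) c (Finset.mem_univ c)
  simp at this

/-- The strictly advanced extended function of `α / β`: the power series `∑ x^T` in the variables
`x_1, x_2, …`, over all tableaux `T` of shape `α / β` whose entries strictly increase in rows and
in columns. Its coefficient at a monomial is the number of those `T` with `x^T` equal to it. -/
def strictAdvExt {n m : ℕ} (α : Composition n) (β : Composition m) : MvPowerSeries ℕ+ ℚ :=
  fun d => ({T : Tableau (skewDiagram α β) | StrictRowsCols T ∧ content T = d}.ncard : ℚ)

open Classical in
/-- The monomial symmetric function `m_μ`: the sum of the distinct monomials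
`x_{i_1}^{μ_1} ⋯ x_{i_ℓ}^{μ_ℓ}` with distinct `i_1, …, i_ℓ`. -/
def monomialSymm {n : ℕ} (μ : Composition n) : MvPowerSeries ℕ+ ℚ :=
  fun d => if ∃ i : Fin μ.length ↪ ℕ+, d = ∑ j, Finsupp.single (i j) (μ.blocksFun j) then 1 else 0

/-- The space `Sym` of symmetric functions, spanned by the `m_μ` over all partitions `μ`. -/
def SymFunctions : Submodule ℚ (MvPowerSeries ℕ+ ℚ) :=
  Submodule.span ℚ {f | ∃ (n : ℕ) (μ : Composition n), IsPartition μ ∧ f = monomialSymm μ}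

/-- The composition `(1^k, N - k)` of `N`, for `0 ≤ k ≤ N - 1`. -/
def onesThenRow (N k : ℕ) (hk : k < N) : Composition N where
  blocks := List.replicate k 1 ++ [N - k]
  blocks_pos := by
    intro i hi
    rcases List.mem_append.mp hi with h | h
    · rw [List.eq_of_mem_replicate h]
      exact Nat.one_pos
    · rw [List.mem_singleton.mp h]
      omega
  blocks_sum := by
    simp
    omega

/-- `α / β` is, as an array of cells, the diagram of the composition `γ`: the two agree after moving
the (left-justified) diagram of `γ` some number `s` of columns to the right. -/
def IsCompShape {n m N : ℕ} (α : Composition n) (β : Composition m) (γ : Composition N) : Prop :=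
  ∃ s : ℕ, skewDiagram α β = (compDiagram γ).image fun c => (c.1, c.2 + s)

end

noncomputable section

/-! Ordered by `cellRel`, the cells form a poset and the tableaux are its strict fillings; the
coefficient of the series at the exponents `l` is `levelCount cellRel l`
(`strictAdvExt_listContent`). The shapes in the theorem are those whose cells form a chain. A chain
of `N` cells has the series e_N = m_(1^N), which is symmetric.

Conversely, symmetry allows blocks of levels to be exchanged: `β ++ γ` and `γ ++ β` have equal level
counts. Signed sums over compositions of `b`, patterned on the expansions of e_b and p_b in complete
homogeneous functions, turn level counts into counts of lower sets of size `b`: with weight 1 every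
lower set contributes once, and with the first part as weight only those with a unique minimal
element do. Exchanging blocks then shows that, in each positive size, as many lower sets as upper
sets have a unique minimal element (`card_lowerSets_eq_card_upperSets`). Take a largest such upper
set and a lower set of the same size with a unique minimal element. The latter must equal its own
upper closure, so by connectedness it is everything (`card_relMinimals_eq_one`).

A second exchange shows that removing a lower set never increases the number of minimal elements
(`card_relMinimals_sdiff_le`). Hence at most one cell is ever minimal, and a skew shape by a
partition with this property is a column with a row on top. -/

/-! ### Level counts, lower sets and signed sums over compositions -/

open Classical in
/-- The elements of `S` that have no `r`-predecessor in `S`. -/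
def relMinimals {X : Type*} (r : X → X → Prop) (S : Finset X) : Finset X :=
  S.filter fun c => ∀ d ∈ S, ¬ r d c

open Classical in
/-- The subsets of `S` of size `b` that contain all `r`-predecessors in `S` of their elements. -/
def relLowerSets {X : Type*} (r : X → X → Prop) (S : Finset X) (b : ℕ) : Finset (Finset X) :=
  (S.powersetCard b).filter fun I => ∀ c ∈ I, ∀ d ∈ S, r d c → d ∈ I

open Classical in
/-- The number of ways to exhaust `S` by removing, one after the other, sets of minimal elements
whose sizes are given by a list. -/
def levelCount {X : Type*} (r : X → X → Prop) : List ℕ → Finset X → ℕ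
  | [], S => if S = ∅ then 1 else 0
  | a :: l, S => ∑ A ∈ (relMinimals r S).powersetCard a, levelCount r l (S \ A)

/-- The lists of positive integers with a given sum. -/
def compositionLists : ℕ → Finset (List ℕ)
  | 0 => {[]}
  | b + 1 => (Finset.univ : Finset (Fin (b + 1))).biUnion fun a =>
      (compositionLists (b - a)).image (List.cons (a + 1))

theorem sum_compositionLists_succ (b : ℕ) (f : List ℕ → ℤ) :
    ∑ β ∈ compositionLists (b + 1), f β =
      ∑ a ∈ Finset.range (b + 1), ∑ β ∈ compositionLists (b - a), f ((a + 1) :: β) := by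
  rw [compositionLists, Finset.sum_biUnion, Finset.sum_range]
  · refine Finset.sum_congr rfl fun a _ => ?_
    rw [Finset.sum_image]
    intro x _ y _ h
    exact (List.cons.inj h).2
  · intro a _ a' _ h
    refine Finset.disjoint_left.mpr fun l hl hl' => h ?_
    obtain ⟨x, _, rfl⟩ := Finset.mem_image.mp hl
    obtain ⟨y, _, hy⟩ := Finset.mem_image.mp hl'
    have := (List.cons.inj hy).1
    exact Fin.ext (by omega)

section
variable {X : Type*} {r : X → X → Prop}

theorem mem_relMinimals {S : Finset X} {c : X} :
    c ∈ relMinimals r S ↔ c ∈ S ∧ ∀ d ∈ S, ¬ r d c := by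
  simp [relMinimals]

theorem relMinimals_subset (S : Finset X) : relMinimals r S ⊆ S := fun _ h =>
  (mem_relMinimals.mp h).1

theorem mem_relLowerSets {S I : Finset X} {b : ℕ} :
    I ∈ relLowerSets r S b ↔ (I ⊆ S ∧ I.card = b) ∧ ∀ c ∈ I, ∀ d ∈ S, r d c → d ∈ I := by
  simp [relLowerSets, Finset.mem_powersetCard]

theorem relMinimals_nonempty (hr : WellFounded r) {S : Finset X} (hS : S.Nonempty) :
    (relMinimals r S).Nonempty := by
  obtain ⟨c, hc, h⟩ := hr.has_min (S : Set X) hS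
  exact ⟨c, mem_relMinimals.mpr ⟨hc, h⟩⟩

theorem relLowerSets_zero (S : Finset X) : relLowerSets r S 0 = {∅} := by
  ext I
  rw [mem_relLowerSets, Finset.mem_singleton, Finset.card_eq_zero]
  constructor
  · exact fun h => h.1.2
  · rintro rfl
    simp

theorem relLowerSets_card (S : Finset X) : relLowerSets r S S.card = {S} := by
  ext I
  rw [mem_relLowerSets, Finset.mem_singleton]
  constructor
  · exact fun h => Finset.eq_of_subset_of_card_le h.1.1 h.1.2.ge
  · rintro rfl
    exact ⟨⟨subset_rfl, rfl⟩, fun _ _ _ h _ => h⟩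

-- The pair `(A, I)` corresponds to the lower set `A ∪ I` of `S` with `A` marked among its minimal
-- elements; the binomial coefficient counts the markings.
open Classical in
theorem sum_powersetCard_relMinimals_sum_relLowerSets (S : Finset X) (a b : ℕ)
    (g : Finset X → ℤ) :
    ∑ A ∈ (relMinimals r S).powersetCard a, ∑ I ∈ relLowerSets r (S \ A) b, g ((S \ A) \ I) =
      ∑ I ∈ relLowerSets r S (a + b), ((relMinimals r I).card.choose a : ℤ) * g (S \ I) := by
  have h1 : ∀ I ∈ relLowerSets r S (a + b), ((relMinimals r I).card.choose a : ℤ) * g (S \ I) =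
      ∑ A ∈ (relMinimals r I).powersetCard a, g (S \ I) := by
    intro I _
    simp [Finset.card_powersetCard]
  rw [Finset.sum_congr rfl h1, Finset.sum_sigma', Finset.sum_sigma']
  refine Finset.sum_bij' (fun p _ => ⟨p.1 ∪ p.2, p.1⟩) (fun p _ => ⟨p.2, p.1 \ p.2⟩) ?_ ?_ ?_ ?_ ?_
  · rintro ⟨A, I⟩ h
    simp only [Finset.mem_sigma, Finset.mem_powersetCard, mem_relLowerSets] at h ⊢
    obtain ⟨⟨hA, hAc⟩, ⟨hI, hIc⟩, hlow⟩ := h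
    have hdisj : Disjoint A I := Finset.disjoint_left.mpr fun x hx hx' =>
      (Finset.mem_sdiff.mp (hI hx')).2 hx
    have hAS := hA.trans (relMinimals_subset S)
    have hIS := hI.trans Finset.sdiff_subset
    refine ⟨⟨⟨Finset.union_subset hAS hIS, ?_⟩, ?_⟩, ?_, hAc⟩
    · rw [Finset.card_union_of_disjoint hdisj, hAc, hIc]
    · intro c hc d hd hdc
      rcases Finset.mem_union.mp hc with hc | hc
      · exact absurd hdc ((mem_relMinimals.mp (hA hc)).2 d hd)
      · by_cases hdA : d ∈ A
        · exact Finset.mem_union_left _ hdA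
        · exact Finset.mem_union_right _ (hlow c hc d (Finset.mem_sdiff.mpr ⟨hd, hdA⟩) hdc)
    · intro c hc
      refine mem_relMinimals.mpr ⟨Finset.mem_union_left _ hc, fun d hd => ?_⟩
      exact (mem_relMinimals.mp (hA hc)).2 d (Finset.union_subset hAS hIS hd)
  · rintro ⟨I, A⟩ h
    simp only [Finset.mem_sigma, Finset.mem_powersetCard, mem_relLowerSets] at h ⊢
    obtain ⟨⟨⟨hI, hIc⟩, hlow⟩, hA, hAc⟩ := h
    have hAI := hA.trans (relMinimals_subset I)
    refine ⟨⟨?_, hAc⟩, ⟨Finset.sdiff_subset_sdiff hI subset_rfl, ?_⟩, ?_⟩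
    · intro c hc
      refine mem_relMinimals.mpr ⟨hI (hAI hc), fun d hd hdc => ?_⟩
      exact (mem_relMinimals.mp (hA hc)).2 d (hlow c (hAI hc) d hd hdc) hdc
    · rw [Finset.card_sdiff_of_subset hAI, hIc, hAc]
      omega
    · intro c hc d hd hdc
      rw [Finset.mem_sdiff] at *
      exact ⟨hlow c hc.1 d hd.1 hdc, hd.2⟩
  · rintro ⟨A, I⟩ h
    simp only [Finset.mem_sigma, Finset.mem_powersetCard, mem_relLowerSets] at h
    have hdisj : Disjoint I A := Finset.disjoint_left.mpr fun x hx hx' =>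
      (Finset.mem_sdiff.mp (h.2.1.1 hx)).2 hx'
    simp [Finset.union_sdiff_cancel_left hdisj.symm]
  · rintro ⟨I, A⟩ h
    simp only [Finset.mem_sigma, Finset.mem_powersetCard, mem_relLowerSets] at h
    simp [Finset.union_sdiff_of_subset (h.2.1.trans (relMinimals_subset I))]
  · rintro ⟨A, I⟩ _
    simp only [sdiff_sdiff_left, Finset.sup_eq_union]

-- Splitting off the first part `a + 1` and applying the unweighted formula to the rest leaves, for
-- each lower set, an alternating binomial sum in its number of minimal elements. The weight `w`
-- lets one computation serve both formulas below.
open Classical in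
theorem sum_compositionLists_succ_levelCount (b : ℕ) (γ : List ℕ) (S : Finset X) (w : ℕ → ℤ)
    (ih : ∀ b' ≤ b, ∀ S : Finset X,
      ∑ β ∈ compositionLists b', (-1 : ℤ) ^ β.length * levelCount r (β ++ γ) S =
        (-1) ^ b' * ∑ I ∈ relLowerSets r S b', (levelCount r γ (S \ I) : ℤ)) :
    ∑ β ∈ compositionLists (b + 1),
        (-1 : ℤ) ^ β.length * (w (β.headD 0) * levelCount r (β ++ γ) S) =
      (-1) ^ (b + 1) * ∑ I ∈ relLowerSets r S (b + 1),
        (∑ a ∈ Finset.range (b + 1),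
          (-1) ^ a * w (a + 1) * ((relMinimals r I).card.choose (a + 1) : ℤ)) *
            (levelCount r γ (S \ I) : ℤ) := by
  rw [sum_compositionLists_succ]
  have h1 : ∀ a ∈ Finset.range (b + 1), ∑ β ∈ compositionLists (b - a),
      (-1 : ℤ) ^ ((a + 1) :: β).length *
        (w (((a + 1) :: β).headD 0) * levelCount r ((a + 1) :: β ++ γ) S) =
      ∑ I ∈ relLowerSets r S (b + 1), (-1) ^ (b + 1) * ((-1) ^ a * w (a + 1) *
        ((relMinimals r I).card.choose (a + 1) : ℤ) * (levelCount r γ (S \ I) : ℤ)) := by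
    intro a ha
    have hab : a ≤ b := by
      have := Finset.mem_range.mp ha
      omega
    have h2 := sum_powersetCard_relMinimals_sum_relLowerSets (r := r) S (a + 1) (b - a)
      (fun U => (levelCount r γ U : ℤ))
    rw [show a + 1 + (b - a) = b + 1 by omega] at h2
    have h3 : ∀ β ∈ compositionLists (b - a), (-1 : ℤ) ^ ((a + 1) :: β).length *
        (w (((a + 1) :: β).headD 0) * levelCount r ((a + 1) :: β ++ γ) S) =
        ∑ A ∈ (relMinimals r S).powersetCard (a + 1),
          (-w (a + 1)) * ((-1) ^ β.length * (levelCount r (β ++ γ) (S \ A) : ℤ)) := by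
      intro β _
      simp only [List.cons_append, levelCount, List.length_cons, List.headD_cons, Nat.cast_sum,
        Finset.mul_sum]
      refine Finset.sum_congr rfl fun A _ => ?_
      ring
    rw [Finset.sum_congr rfl h3, Finset.sum_comm]
    simp_rw [← Finset.mul_sum]
    rw [Finset.sum_congr rfl fun A _ => ih (b - a) (Nat.sub_le b a) (S \ A), ← Finset.mul_sum, h2]
    have h4 : (-1 : ℤ) ^ (b + 1) = -((-1) ^ (b - a) * (-1) ^ a) := by
      rw [← pow_add, Nat.sub_add_cancel hab, pow_succ]
      ring
    have h5 : (-1 : ℤ) ^ a * (-1) ^ a = 1 := by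
      rw [← mul_pow]
      simp
    rw [h4, Finset.mul_sum, Finset.mul_sum, Finset.mul_sum]
    refine Finset.sum_congr rfl fun I _ => ?_
    linear_combination (w (a + 1) * (-1) ^ (b - a) * ((relMinimals r I).card.choose (a + 1) : ℤ) *
      (levelCount r γ (S \ I) : ℤ)) * h5
  rw [Finset.sum_congr rfl h1, Finset.sum_comm, Finset.mul_sum]
  refine Finset.sum_congr rfl fun I _ => ?_
  rw [← Finset.mul_sum, Finset.sum_mul]

theorem sum_range_neg_one_pow_choose_succ {k b : ℕ} (hk : 0 < k) (hkb : k ≤ b) :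
    ∑ a ∈ Finset.range b, (-1 : ℤ) ^ a * (k.choose (a + 1) : ℤ) = 1 := by
  have h := Int.alternating_sum_range_choose (n := k)
  rw [if_neg hk.ne', Finset.sum_range_succ'] at h
  have h2 : ∑ a ∈ Finset.range b, (-1 : ℤ) ^ a * (k.choose (a + 1) : ℤ) =
      ∑ a ∈ Finset.range k, (-1 : ℤ) ^ a * (k.choose (a + 1) : ℤ) := by
    symm
    refine Finset.sum_subset (Finset.range_mono hkb) fun x _ hx => ?_
    rw [Nat.choose_eq_zero_of_lt (by simpa using hx)]
    simp
  rw [h2]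
  have h3 : ∑ a ∈ Finset.range k, (-1 : ℤ) ^ (a + 1) * (k.choose (a + 1) : ℤ) =
      - ∑ a ∈ Finset.range k, (-1 : ℤ) ^ a * (k.choose (a + 1) : ℤ) := by
    rw [← Finset.sum_neg_distrib]
    exact Finset.sum_congr rfl fun a _ => by ring
  rw [h3] at h
  simp at h
  linarith

/-- Absorption, (a+1)·C(k,a+1) = k·C(k-1,a), reduces this to the alternating sum of row k-1, which
vanishes unless k = 1. -/
theorem sum_range_neg_one_pow_succ_mul_choose_succ {k b : ℕ} (hk : 0 < k) (hkb : k ≤ b) :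
    ∑ a ∈ Finset.range b, (-1 : ℤ) ^ a * ((a + 1 : ℕ) : ℤ) * (k.choose (a + 1) : ℤ) =
      if k = 1 then 1 else 0 := by
  obtain ⟨k, rfl⟩ : ∃ j, k = j + 1 := ⟨k - 1, by omega⟩
  have h2 : ∑ a ∈ Finset.range b, (-1 : ℤ) ^ a * ((a + 1 : ℕ) : ℤ) * ((k + 1).choose (a + 1) : ℤ) =
      ∑ a ∈ Finset.range (k + 1), (-1 : ℤ) ^ a * ((a + 1 : ℕ) : ℤ) *
        ((k + 1).choose (a + 1) : ℤ) := by
    symm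
    refine Finset.sum_subset (Finset.range_mono hkb) fun x _ hx => ?_
    rw [Nat.choose_eq_zero_of_lt (by simpa using hx)]
    simp
  have h3 : ∀ a ∈ Finset.range (k + 1), (-1 : ℤ) ^ a * ((a + 1 : ℕ) : ℤ) *
      ((k + 1).choose (a + 1) : ℤ) = ((k + 1 : ℕ) : ℤ) * ((-1) ^ a * (k.choose a : ℤ)) := by
    intro a _
    have := Nat.add_one_mul_choose_eq k a
    have h : ((k + 1 : ℕ) : ℤ) * (k.choose a : ℤ) =
        ((k + 1).choose (a + 1) : ℤ) * ((a + 1 : ℕ) : ℤ) := by exact_mod_cast this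
    linear_combination (-(-1) ^ a) * h
  rw [h2, Finset.sum_congr rfl h3, ← Finset.mul_sum, Int.alternating_sum_range_choose]
  rcases k with _ | k <;> simp

open Classical in
theorem sum_compositionLists_levelCount (hr : WellFounded r) (γ : List ℕ) (b : ℕ) :
    ∀ S : Finset X, ∑ β ∈ compositionLists b, (-1 : ℤ) ^ β.length * levelCount r (β ++ γ) S =
      (-1) ^ b * ∑ I ∈ relLowerSets r S b, (levelCount r γ (S \ I) : ℤ) := by
  induction b using Nat.strong_induction_on with
  | _ b ih =>
    intro S
    rcases b with _ | b
    · simp [compositionLists, relLowerSets_zero]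
    · have h := sum_compositionLists_succ_levelCount (r := r) b γ S (fun _ => 1)
        (fun b' hb' => ih b' (by omega))
      simp only [one_mul, mul_one] at h
      rw [h]
      congr 1
      refine Finset.sum_congr rfl fun I hI => ?_
      obtain ⟨⟨_, hIc⟩, _⟩ := mem_relLowerSets.mp hI
      have hne : I.Nonempty := Finset.card_pos.mp (by omega)
      rw [sum_range_neg_one_pow_choose_succ (Finset.card_pos.mpr (relMinimals_nonempty hr hne))
        (hIc ▸ Finset.card_le_card (relMinimals_subset I)), one_mul]

open Classical in
theorem sum_compositionLists_head_mul_levelCount (hr : WellFounded r) (γ : List ℕ) {b : ℕ}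
    (hb : 0 < b) (S : Finset X) :
    ∑ β ∈ compositionLists b, (-1 : ℤ) ^ β.length * ((β.headD 0 : ℤ) * levelCount r (β ++ γ) S) =
      (-1) ^ b * ∑ I ∈ (relLowerSets r S b).filter fun I => (relMinimals r I).card = 1,
        (levelCount r γ (S \ I) : ℤ) := by
  obtain ⟨b, rfl⟩ : ∃ j, b = j + 1 := ⟨b - 1, by omega⟩
  rw [sum_compositionLists_succ_levelCount (r := r) b γ S (fun a => (a : ℤ))
    (fun b' _ => sum_compositionLists_levelCount hr γ b'), Finset.sum_filter]
  congr 1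
  refine Finset.sum_congr rfl fun I hI => ?_
  obtain ⟨⟨_, hIc⟩, _⟩ := mem_relLowerSets.mp hI
  have hne : I.Nonempty := Finset.card_pos.mp (by omega)
  rw [sum_range_neg_one_pow_succ_mul_choose_succ
    (Finset.card_pos.mpr (relMinimals_nonempty hr hne))
    (hIc ▸ Finset.card_le_card (relMinimals_subset I))]
  simp

open Classical in
/-- If the level counts of `S` are invariant under exchanging blocks of levels, then `S` has as many
lower sets of size `M` with a unique minimal element as upper sets. -/
theorem card_lowerSets_eq_card_upperSets (hr : WellFounded r) {S : Finset X}
    (hsymm : ∀ β γ, levelCount r (β ++ γ) S = levelCount r (γ ++ β) S) {M : ℕ} (hM : 0 < M)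
    (hMS : M ≤ S.card) :
    ((relLowerSets r S M).filter fun I => (relMinimals r I).card = 1).card =
      ((relLowerSets r S (S.card - M)).filter fun I => (relMinimals r (S \ I)).card = 1).card := by
  have hlow : ∀ b, ∀ I ∈ relLowerSets r S b, (S \ I).card = S.card - b := by
    intro b I hI
    obtain ⟨⟨hIS, hIc⟩, _⟩ := mem_relLowerSets.mp hI
    rw [Finset.card_sdiff_of_subset hIS, hIc]
  -- With the weighted block removed first, it selects a lower set `I` with a unique minimal
  -- element; the unweighted block then has only `S \ I` left to take.
  have hL : ∑ β ∈ compositionLists (S.card - M), ∑ γ ∈ compositionLists M,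
      (-1 : ℤ) ^ β.length * ((-1) ^ γ.length * ((γ.headD 0 : ℤ) * levelCount r (γ ++ β) S)) =
      (-1) ^ M * (-1) ^ (S.card - M) *
        ((relLowerSets r S M).filter fun I => (relMinimals r I).card = 1).card := by
    have h1 : ∀ β ∈ compositionLists (S.card - M), ∑ γ ∈ compositionLists M,
        (-1 : ℤ) ^ β.length * ((-1) ^ γ.length * ((γ.headD 0 : ℤ) * levelCount r (γ ++ β) S)) =
        (-1) ^ M * ∑ I ∈ (relLowerSets r S M).filter fun I => (relMinimals r I).card = 1,
          (-1) ^ β.length * (levelCount r β (S \ I) : ℤ) := by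
      intro β _
      rw [← Finset.mul_sum, sum_compositionLists_head_mul_levelCount hr _ hM S, ← Finset.mul_sum]
      ring
    rw [Finset.sum_congr rfl h1, ← Finset.mul_sum, Finset.sum_comm, mul_assoc]
    congr 1
    rw [mul_comm, ← nsmul_eq_mul, ← Finset.sum_const]
    refine Finset.sum_congr rfl fun I hI => ?_
    have h := sum_compositionLists_levelCount hr [] (S.card - M) (S \ I)
    simp only [List.append_nil] at h
    rw [h, ← hlow M I (Finset.mem_filter.mp hI).1, relLowerSets_card, Finset.sum_singleton,
      Finset.sdiff_self]
    simp [levelCount]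
  -- With the weighted block removed last, it tests whether the upper set `S \ I` has a unique
  -- minimal element.
  have hR : ∑ β ∈ compositionLists (S.card - M), ∑ γ ∈ compositionLists M,
      (-1 : ℤ) ^ β.length * ((-1) ^ γ.length * ((γ.headD 0 : ℤ) * levelCount r (β ++ γ) S)) =
      (-1) ^ M * (-1) ^ (S.card - M) * ((relLowerSets r S (S.card - M)).filter
        fun I => (relMinimals r (S \ I)).card = 1).card := by
    rw [Finset.sum_comm]
    have h1 : ∀ γ ∈ compositionLists M, ∑ β ∈ compositionLists (S.card - M),
        (-1 : ℤ) ^ β.length * ((-1) ^ γ.length * ((γ.headD 0 : ℤ) * levelCount r (β ++ γ) S)) =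
        (-1) ^ (S.card - M) * ∑ I ∈ relLowerSets r S (S.card - M),
          (-1) ^ γ.length * ((γ.headD 0 : ℤ) * levelCount r γ (S \ I)) := by
      intro γ _
      have h := sum_compositionLists_levelCount hr γ (S.card - M) S
      calc _ = ∑ β ∈ compositionLists (S.card - M), ((-1 : ℤ) ^ γ.length * (γ.headD 0 : ℤ)) *
            ((-1) ^ β.length * levelCount r (β ++ γ) S) :=
            Finset.sum_congr rfl fun β _ => by ring
        _ = _ := by
            rw [← Finset.mul_sum, h, Finset.mul_sum, Finset.mul_sum, Finset.mul_sum]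
            exact Finset.sum_congr rfl fun I _ => by ring
    rw [Finset.sum_congr rfl h1, ← Finset.mul_sum, Finset.sum_comm, mul_comm ((-1 : ℤ) ^ M),
      mul_assoc, Finset.card_filter, Nat.cast_sum]
    congr 1
    rw [Finset.mul_sum]
    refine Finset.sum_congr rfl fun I hI => ?_
    have h := sum_compositionLists_head_mul_levelCount hr [] hM (S \ I)
    simp only [List.append_nil] at h
    have hc : M = (S \ I).card := by
      rw [hlow _ I hI]
      omega
    rw [h]
    congr 1
    rw [hc, relLowerSets_card, Finset.sum_filter]
    simp [levelCount]
  have hLR : ∑ β ∈ compositionLists (S.card - M), ∑ γ ∈ compositionLists M,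
      (-1 : ℤ) ^ β.length * ((-1) ^ γ.length * ((γ.headD 0 : ℤ) * levelCount r (γ ++ β) S)) =
      ∑ β ∈ compositionLists (S.card - M), ∑ γ ∈ compositionLists M,
      (-1 : ℤ) ^ β.length * ((-1) ^ γ.length * ((γ.headD 0 : ℤ) * levelCount r (β ++ γ) S)) :=
    Finset.sum_congr rfl fun β _ => Finset.sum_congr rfl fun γ _ => by rw [hsymm γ β]
  have h := hL.symm.trans (hLR.trans hR)
  have h0 : (-1 : ℤ) ^ M * (-1) ^ (S.card - M) ≠ 0 := by positivity
  exact_mod_cast mul_left_cancel₀ h0 h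

end

/-! ### Consequences of block exchange for minimal elements -/

open Classical in
/-- The smallest upper set of `D` (for `r`) that contains `J`. -/
def relUpperClosure {X : Type*} (r : X → X → Prop) (D J : Finset X) : Finset X :=
  D.filter fun x => ∃ y ∈ J, Relation.ReflTransGen (fun a b => r a b ∧ a ∈ D ∧ b ∈ D) y x

section
variable {X : Type*} {r : X → X → Prop}

theorem mem_relUpperClosure {D J : Finset X} {x : X} :
    x ∈ relUpperClosure r D J ↔
      x ∈ D ∧ ∃ y ∈ J, Relation.ReflTransGen (fun a b => r a b ∧ a ∈ D ∧ b ∈ D) y x := by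
  simp [relUpperClosure]

theorem subset_relUpperClosure {D J : Finset X} (hJ : J ⊆ D) : J ⊆ relUpperClosure r D J :=
  fun _ hx => mem_relUpperClosure.mpr ⟨hJ hx, _, hx, .refl⟩

theorem mem_relUpperClosure_of_rel {D J : Finset X} {c d : X} (hc : c ∈ relUpperClosure r D J)
    (hd : d ∈ D) (hcd : r c d) : d ∈ relUpperClosure r D J := by
  obtain ⟨hcD, y, hy, h⟩ := mem_relUpperClosure.mp hc
  exact mem_relUpperClosure.mpr ⟨hd, y, hy, h.tail ⟨hcd, hcD, hd⟩⟩

/-- An element reached by a nontrivial path has a predecessor in the closure, while elements of the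
lower set `J` gain no new predecessors. -/
theorem relMinimals_relUpperClosure {D J : Finset X} (hJ : J ⊆ D)
    (hlow : ∀ c ∈ J, ∀ d ∈ D, r d c → d ∈ J) :
    relMinimals r (relUpperClosure r D J) = relMinimals r J := by
  ext x
  rw [mem_relMinimals, mem_relMinimals]
  constructor
  · rintro ⟨hx, hmin⟩
    obtain ⟨hxD, y, hy, h⟩ := mem_relUpperClosure.mp hx
    rcases Relation.ReflTransGen.cases_tail h with rfl | ⟨z, hyz, hzx, hz, _⟩
    · exact ⟨hy, fun d hd => hmin d (subset_relUpperClosure hJ hd)⟩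
    · exact absurd hzx (hmin z (mem_relUpperClosure.mpr ⟨hz, y, hy, hyz⟩))
  · rintro ⟨hx, hmin⟩
    refine ⟨subset_relUpperClosure hJ hx, fun d hd hdx => ?_⟩
    exact hmin d (hlow x hx d (mem_relUpperClosure.mp hd).1 hdx) hdx

open Classical in
/-- If the level counts of a connected `D` are invariant under exchanging blocks of levels, then `D`
has a unique minimal element. -/
theorem card_relMinimals_eq_one (hr : WellFounded r) {D : Finset X} (hD : D.Nonempty)
    (hsymm : ∀ β γ, levelCount r (β ++ γ) D = levelCount r (γ ++ β) D)
    (hconn : ∀ J ⊆ D, J.Nonempty → (∀ c ∈ J, ∀ d ∈ D, r c d ∨ r d c → d ∈ J) → J = D) :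
    (relMinimals r D).card = 1 := by
  set 𝒰 : Finset (Finset X) := D.powerset.filter fun U =>
    (∀ c ∈ U, ∀ d ∈ D, r c d → d ∈ U) ∧ (relMinimals r U).card = 1 with h𝒰
  have hclos : ∀ J ⊆ D, (∀ c ∈ J, ∀ d ∈ D, r d c → d ∈ J) → (relMinimals r J).card = 1 →
      relUpperClosure r D J ∈ 𝒰 := by
    intro J hJ hlow h1
    rw [h𝒰, Finset.mem_filter, Finset.mem_powerset, relMinimals_relUpperClosure hJ hlow]
    exact ⟨fun x hx => (mem_relUpperClosure.mp hx).1,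
      fun c hc d hd hcd => mem_relUpperClosure_of_rel hc hd hcd, h1⟩
  -- The upper closure of a single minimal element of `D` qualifies.
  have hne : 𝒰.Nonempty := by
    obtain ⟨m, hm⟩ := relMinimals_nonempty hr hD
    obtain ⟨hmD, hmin⟩ := mem_relMinimals.mp hm
    have hlow : ∀ c ∈ ({m} : Finset X), ∀ d ∈ D, r d c → d ∈ ({m} : Finset X) := by
      intro c hc d hd hdc
      rw [Finset.mem_singleton.mp hc] at hdc
      exact absurd hdc (hmin d hd)
    refine ⟨_, hclos {m} (by simpa using hmD) hlow ?_⟩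
    rw [Finset.card_eq_one]
    refine ⟨m, Finset.eq_singleton_iff_nonempty_unique_mem.mpr ⟨relMinimals_nonempty hr (by simp),
      fun x hx => Finset.mem_singleton.mp (relMinimals_subset _ hx)⟩⟩
  obtain ⟨U, hU, hmax⟩ := Finset.exists_max_image 𝒰 Finset.card hne
  obtain ⟨hUD, hUup, hU1⟩ : U ⊆ D ∧ (∀ c ∈ U, ∀ d ∈ D, r c d → d ∈ U) ∧
      (relMinimals r U).card = 1 := by simpa [h𝒰] using hU
  have hUpos : 0 < U.card := by
    have := Finset.card_le_card (relMinimals_subset (r := r) U)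
    omega
  have hcount := card_lowerSets_eq_card_upperSets hr hsymm hUpos (Finset.card_le_card hUD)
  have hmem : D \ U ∈ (relLowerSets r D (D.card - U.card)).filter
      fun I => (relMinimals r (D \ I)).card = 1 := by
    rw [Finset.mem_filter, mem_relLowerSets, Finset.sdiff_sdiff_eq_self hUD]
    refine ⟨⟨⟨Finset.sdiff_subset, Finset.card_sdiff_of_subset hUD⟩, ?_⟩, hU1⟩
    intro c hc d hd hdc
    rw [Finset.mem_sdiff] at hc ⊢
    exact ⟨hd, fun hdU => hc.2 (hUup d hdU c hc.1 hdc)⟩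
  obtain ⟨J, hJ⟩ := Finset.card_pos.mp (hcount ▸ Finset.card_pos.mpr ⟨_, hmem⟩)
  obtain ⟨hJl, hJ1⟩ := Finset.mem_filter.mp hJ
  obtain ⟨⟨hJD, hJc⟩, hlow⟩ := mem_relLowerSets.mp hJl
  -- The closure lies in `𝒰`, so it has at most `U.card = J.card` elements.
  have hJU : J = relUpperClosure r D J :=
    Finset.eq_of_subset_of_card_le (subset_relUpperClosure hJD)
      (hJc ▸ hmax _ (hclos J hJD hlow hJ1))
  have hJeq : J = D := by
    refine hconn J hJD (Finset.card_pos.mp (hJc ▸ hUpos)) ?_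
    rintro c hc d hd (h | h)
    · rw [hJU] at hc ⊢
      exact mem_relUpperClosure_of_rel hc hd h
    · exact hlow c hc d hd h
  rw [← hJeq, hJ1]

open Classical in
theorem levelCount_replicate_one_pos (hr : WellFounded r) :
    ∀ (k : ℕ) (S : Finset X), S.card = k → 0 < levelCount r (List.replicate k 1) S
  | 0, S, h => by simp [levelCount, Finset.card_eq_zero.mp h]
  | k + 1, S, h => by
    obtain ⟨m, hm⟩ := relMinimals_nonempty hr (Finset.card_pos.mp (by omega : 0 < S.card))
    rw [List.replicate_succ, levelCount]
    refine Finset.sum_pos' (fun _ _ => Nat.zero_le _) ⟨{m}, ?_, ?_⟩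
    · simpa [Finset.mem_powersetCard] using hm
    · refine levelCount_replicate_one_pos hr k _ ?_
      rw [Finset.card_sdiff_of_subset (by simpa using relMinimals_subset S hm), h]
      simp

-- The elements of `I` can be removed one at a time, always taking a minimal one; it is minimal in
-- `S` too because `I` is a lower set.
open Classical in
theorem levelCount_replicate_one_append_pos (hr : WellFounded r) (γ : List ℕ) :
    ∀ (k : ℕ) (S I : Finset X), I ∈ relLowerSets r S k → 0 < levelCount r γ (S \ I) →
      0 < levelCount r (List.replicate k 1 ++ γ) S
  | 0, S, I, hI, h => by
    rw [relLowerSets_zero, Finset.mem_singleton] at hI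
    simpa [hI] using h
  | k + 1, S, I, hI, h => by
    obtain ⟨⟨hIS, hIc⟩, hlow⟩ := mem_relLowerSets.mp hI
    obtain ⟨m, hm⟩ := relMinimals_nonempty hr (Finset.card_pos.mp (by omega : 0 < I.card))
    obtain ⟨hmI, hmin⟩ := mem_relMinimals.mp hm
    rw [List.replicate_succ, List.cons_append, levelCount]
    refine Finset.sum_pos' (fun _ _ => Nat.zero_le _) ⟨{m}, ?_, ?_⟩
    · rw [Finset.mem_powersetCard, Finset.singleton_subset_iff, mem_relMinimals]
      exact ⟨⟨hIS hmI, fun d hd hdm => hmin d (hlow m hmI d hd hdm) hdm⟩, by simp⟩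
    · refine levelCount_replicate_one_append_pos hr γ k _ (I \ {m}) ?_ ?_
      · rw [mem_relLowerSets, Finset.card_sdiff_of_subset (by simpa using hmI), hIc]
        refine ⟨⟨Finset.sdiff_subset_sdiff hIS subset_rfl, by simp⟩, ?_⟩
        intro c hc d hd hdc
        rw [Finset.mem_sdiff] at *
        exact ⟨hlow c hc.1 d hd.1 hdc, hd.2⟩
      · rwa [sdiff_sdiff_left, Finset.sup_eq_union,
          Finset.union_sdiff_of_subset (by simpa using hmI)]

open Classical in
theorem card_relMinimals_sdiff_le (hr : WellFounded r) {D : Finset X}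
    (hsymm : ∀ β γ, levelCount r (β ++ γ) D = levelCount r (γ ++ β) D) {I : Finset X} (hI : I ⊆ D)
    (hlow : ∀ c ∈ I, ∀ d ∈ D, r d c → d ∈ I) :
    (relMinimals r (D \ I)).card ≤ (relMinimals r D).card := by
  set A := relMinimals r (D \ I) with hA
  -- After `I` is removed in singletons, all of `A` can go as one level. Exchanging the blocks puts
  -- a level of size `A.card` first, and it must consist of minimal elements of `D`.
  set γ := A.card :: List.replicate ((D \ I) \ A).card 1 with hγ
  have h1 : 0 < levelCount r γ (D \ I) := by
    rw [hγ, levelCount]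
    exact Finset.sum_pos' (fun _ _ => Nat.zero_le _) ⟨A, by simp [hA],
      levelCount_replicate_one_pos hr _ _ rfl⟩
  have h2 := levelCount_replicate_one_append_pos hr γ I.card D I
    (mem_relLowerSets.mpr ⟨⟨hI, rfl⟩, hlow⟩) h1
  rw [hsymm, hγ, List.cons_append, levelCount] at h2
  obtain ⟨B, hB, _⟩ := Finset.exists_ne_zero_of_sum_ne_zero h2.ne'
  obtain ⟨hB, hBc⟩ := Finset.mem_powersetCard.mp hB
  exact hBc ▸ Finset.card_le_card hB

end

/-! ### Level counts as coefficients of the tableau series -/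

/-- Of two cells in the same column the lower one precedes the upper one, and of two cells in the
same row the left one precedes the right one. -/
def cellRel (c d : ℕ × ℕ) : Prop := (c.2 = d.2 ∧ c.1 < d.1) ∨ (c.1 = d.1 ∧ c.2 < d.2)

theorem cellRel_wellFounded : WellFounded cellRel := by
  refine Subrelation.wf (r := InvImage (· < ·) fun c : ℕ × ℕ => c.1 + c.2) ?_
    (InvImage.wf _ wellFounded_lt)
  intro c d h
  change c.1 + c.2 < d.1 + d.2
  rcases h with h | h <;> omega

theorem strictRowsCols_iff {D : Finset (ℕ × ℕ)} (T : Tableau D) :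
    StrictRowsCols T ↔ ∀ c d : {c : ℕ × ℕ // c ∈ D}, cellRel c.1 d.1 → T c < T d := by
  constructor
  · rintro ⟨h1, h2⟩ c d (h | h)
    · exact h1 c d h.1 h.2
    · exact h2 c d h.1 h.2
  · exact fun h => ⟨fun c d h1 h2 => h c d (Or.inl ⟨h1, h2⟩),
      fun c d h1 h2 => h c d (Or.inr ⟨h1, h2⟩)⟩

/-- The exponent vector whose entries are listed by `l`. -/
def listContent (l : List ℕ) : ℕ+ →₀ ℕ :=
  Finsupp.comapDomain PNat.natPred l.toFinsupp PNat.natPred_injective.injOn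

theorem listContent_apply (l : List ℕ) (i : ℕ+) : listContent l i = l.getD i.natPred 0 := by
  simp [listContent, List.toFinsupp_apply]

theorem listContent_nil : listContent [] = 0 := by
  ext i
  simp [listContent_apply]

theorem listContent_cons (a : ℕ) (l : List ℕ) :
    listContent (a :: l) = (listContent l).mapDomain (· + 1) + Finsupp.single 1 a := by
  ext i
  rw [listContent_apply, Finsupp.add_apply]
  induction i using PNat.recOn with
  | one =>
    rw [Finsupp.mapDomain_of_notMem_range]
    · simp [PNat.natPred]
    · rintro ⟨x, hx⟩
      exact (PNat.lt_add_left 1 x).ne' hx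
  | succ i _ =>
    rw [Finsupp.mapDomain_apply (f := fun x : ℕ+ => x + 1) (add_left_injective 1),
      listContent_apply, Finsupp.single_eq_of_ne (PNat.lt_add_left 1 i).ne']
    have : (i + 1).natPred = i.natPred + 1 := by
      have h1 := PNat.natPred_add_one i
      have h2 := PNat.natPred_add_one (i + 1)
      rw [PNat.add_coe, PNat.one_coe] at h2
      omega
    rw [this, List.getD_cons_succ, add_zero]

theorem content_apply {D : Finset (ℕ × ℕ)} (T : Tableau D) (i : ℕ+) :
    content T i = (Finset.univ.filter fun c => T c = i).card := by
  rw [content, Finsupp.finsetSum_apply, Finset.card_filter]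
  exact Finset.sum_congr rfl fun c _ => Finsupp.single_apply

/-- `T` has the entry `1` in the cells of `A` and is elsewhere larger by `1` than `T'`. -/
def IsLevelExtension {D A : Finset (ℕ × ℕ)} (T : Tableau D) (T' : Tableau (D \ A)) : Prop :=
  (∀ c, c.1 ∈ A → T c = 1) ∧
    ∀ (c) (h : c ∈ D \ A), T ⟨c, (Finset.mem_sdiff.mp h).1⟩ = T' ⟨c, h⟩ + 1

theorem IsLevelExtension.content_eq {D A : Finset (ℕ × ℕ)} {T : Tableau D} {T' : Tableau (D \ A)}
    (h : IsLevelExtension T T') (hA : A ⊆ D) :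
    content T = (content T').mapDomain (· + 1) + Finsupp.single 1 A.card := by
  classical
  have h0 : content T = ∑ c ∈ D.attach, Finsupp.single (T c) 1 := rfl
  let t : ℕ × ℕ → ℕ+ := fun c => if h : c ∈ D then T ⟨c, h⟩ else 1
  have ht : ∀ c (hc : c ∈ D), t c = T ⟨c, hc⟩ := fun c hc => dif_pos hc
  have h1 : content T = ∑ c ∈ D, Finsupp.single (t c) 1 := by
    rw [h0, ← Finset.sum_attach D]
    exact Finset.sum_congr rfl fun c _ => by rw [ht c.1 c.2]
  have h2 : (content T').mapDomain (· + 1) = ∑ c ∈ D \ A, Finsupp.single (t c) 1 := by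
    have h3 : content T' = ∑ c ∈ (D \ A).attach, Finsupp.single (T' c) 1 := rfl
    rw [h3, Finsupp.mapDomain_finsetSum, ← Finset.sum_attach (D \ A)]
    refine Finset.sum_congr rfl fun c _ => ?_
    rw [Finsupp.mapDomain_single, ht c.1 (Finset.mem_sdiff.mp c.2).1, h.2 c.1 c.2]
  have h4 : ∑ c ∈ A, Finsupp.single (t c) 1 = Finsupp.single (1 : ℕ+) A.card := by
    rw [Finset.sum_congr rfl fun c hc => by rw [ht c (hA hc), h.1 ⟨c, hA hc⟩ hc],
      Finset.sum_const, Finsupp.smul_single]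
    simp
  rw [h1, h2, ← h4, Finset.sum_sdiff hA]

theorem IsLevelExtension.strictRowsCols_iff {D A : Finset (ℕ × ℕ)} {T : Tableau D}
    {T' : Tableau (D \ A)} (h : IsLevelExtension T T') (hA : A ⊆ relMinimals cellRel D) :
    StrictRowsCols T ↔ StrictRowsCols T' := by
  rw [_root_.strictRowsCols_iff, _root_.strictRowsCols_iff]
  constructor
  · intro hT c d hcd
    have := hT ⟨c.1, (Finset.mem_sdiff.mp c.2).1⟩ ⟨d.1, (Finset.mem_sdiff.mp d.2).1⟩ hcd
    rw [h.2 c.1 c.2, h.2 d.1 d.2] at this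
    exact lt_of_add_lt_add_right this
  · rintro hT ⟨c, hc⟩ ⟨d, hd⟩ hcd
    by_cases hdA : d ∈ A
    · exact absurd hcd ((mem_relMinimals.mp (hA hdA)).2 c hc)
    · have hd' := Finset.mem_sdiff.mpr ⟨hd, hdA⟩
      rw [h.2 d hd']
      by_cases hcA : c ∈ A
      · rw [h.1 ⟨c, hc⟩ hcA]
        exact PNat.lt_add_left _ _
      · have hc' := Finset.mem_sdiff.mpr ⟨hc, hcA⟩
        rw [h.2 c hc']
        exact add_lt_add_left (hT ⟨c, hc'⟩ ⟨d, hd'⟩ hcd) 1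

/-- The strict tableaux of a given shape and content. -/
def strictTableaux (D : Finset (ℕ × ℕ)) (d : ℕ+ →₀ ℕ) : Finset (Tableau D) :=
  (finite_tableaux_content D d).toFinset

theorem mem_strictTableaux {D : Finset (ℕ × ℕ)} {d : ℕ+ →₀ ℕ} {T : Tableau D} :
    T ∈ strictTableaux D d ↔ StrictRowsCols T ∧ content T = d := by
  simp [strictTableaux]

/-- The cells with entry `1`. -/
def unitCells {D : Finset (ℕ × ℕ)} (T : Tableau D) : Finset (ℕ × ℕ) :=
  (Finset.univ.filter fun c => T c = 1).map (Function.Embedding.subtype _)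

theorem mem_unitCells {D : Finset (ℕ × ℕ)} {T : Tableau D} {c : ℕ × ℕ} :
    c ∈ unitCells T ↔ ∃ h : c ∈ D, T ⟨c, h⟩ = 1 := by
  simp [unitCells]

/-- Deleting the entries 1 and lowering the others by 1 is a bijection; this is the recursion
defining `levelCount`. -/
theorem card_filter_unitCells {D A : Finset (ℕ × ℕ)} {a : ℕ} {l : List ℕ}
    (hA : A ∈ (relMinimals cellRel D).powersetCard a) :
    ((strictTableaux D (listContent (a :: l))).filter fun T => unitCells T = A).card =
      (strictTableaux (D \ A) (listContent l)).card := by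
  classical
  obtain ⟨hA, hAc⟩ := Finset.mem_powersetCard.mp hA
  have hAD := hA.trans (relMinimals_subset D)
  have key : ∀ (T : Tableau D) (T' : Tableau (D \ A)), IsLevelExtension T T' →
      (T ∈ strictTableaux D (listContent (a :: l)) ↔
        T' ∈ strictTableaux (D \ A) (listContent l)) := by
    intro T T' h
    rw [mem_strictTableaux, mem_strictTableaux, h.strictRowsCols_iff hA, h.content_eq hAD,
      listContent_cons, hAc, add_left_inj,
      (Finsupp.mapDomain_injective (add_left_injective (1 : ℕ+))).eq_iff]
  let down : Tableau D → Tableau (D \ A) := fun T c => T ⟨c.1, (Finset.mem_sdiff.mp c.2).1⟩ - 1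
  let up : Tableau (D \ A) → Tableau D := fun T' c =>
    if h : c.1 ∈ A then 1 else T' ⟨c.1, Finset.mem_sdiff.mpr ⟨c.2, h⟩⟩ + 1
  have hdown : ∀ T : Tableau D, unitCells T = A → IsLevelExtension T (down T) := by
    intro T hT
    refine ⟨fun c hc => ?_, fun c hc => ?_⟩
    · rw [← hT] at hc
      exact (mem_unitCells.mp hc).2
    · have h1 : T ⟨c, (Finset.mem_sdiff.mp hc).1⟩ ≠ 1 := by
        intro h1
        refine (Finset.mem_sdiff.mp hc).2 ?_
        rw [← hT]
        exact mem_unitCells.mpr ⟨_, h1⟩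
      exact (PNat.sub_add_of_lt (lt_of_le_of_ne (one_le) (Ne.symm h1))).symm
  have hup : ∀ T', IsLevelExtension (up T') T' := by
    intro T'
    refine ⟨fun c hc => dif_pos hc, fun c hc => dif_neg (Finset.mem_sdiff.mp hc).2⟩
  have hunit : ∀ T', unitCells (up T') = A := by
    intro T'
    ext c
    rw [mem_unitCells]
    constructor
    · rintro ⟨hc, h⟩
      by_contra hcA
      rw [(hup T').2 c (Finset.mem_sdiff.mpr ⟨hc, hcA⟩)] at h
      exact (PNat.lt_add_left 1 _).ne' h
    · exact fun hc => ⟨hAD hc, (hup T').1 ⟨c, hAD hc⟩ hc⟩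
  refine Finset.card_nbij' down up ?_ ?_ ?_ ?_
  · intro T hT
    obtain ⟨h1, h2⟩ := Finset.mem_filter.mp hT
    exact (key T _ (hdown T h2)).mp h1
  · intro T' hT'
    exact Finset.mem_filter.mpr ⟨(key _ T' (hup T')).mpr hT', hunit T'⟩
  · intro T hT
    have h2 := hdown T (Finset.mem_filter.mp hT).2
    ext1 c
    by_cases hc : c.1 ∈ A
    · rw [(hup _).1 c hc, h2.1 c hc]
    · have hc' := Finset.mem_sdiff.mpr ⟨c.2, hc⟩
      rw [(hup _).2 c.1 hc', h2.2 c.1 hc']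
  · intro T' _
    ext1 c
    have h1 := (hdown (up T') (hunit T')).2 c.1 c.2
    rw [(hup T').2 c.1 c.2] at h1
    exact (add_right_cancel h1).symm

theorem card_strictTableaux_listContent (l : List ℕ) : ∀ D : Finset (ℕ × ℕ),
    (strictTableaux D (listContent l)).card = levelCount cellRel l D := by
  induction l with
  | nil =>
    intro D
    rw [levelCount, listContent_nil]
    split_ifs with h
    · subst h
      rw [Finset.card_eq_one]
      refine ⟨fun _ => 1, Finset.eq_singleton_iff_unique_mem.mpr ⟨?_, ?_⟩⟩
      · rw [mem_strictTableaux, strictRowsCols_iff]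
        exact ⟨fun c => absurd c.2 (Finset.notMem_empty _), by simp [content]⟩
      · intro T _
        ext1 c
        exact absurd c.2 (Finset.notMem_empty _)
    · rw [Finset.card_eq_zero, Finset.eq_empty_iff_forall_notMem]
      intro T hT
      obtain ⟨c, hc⟩ := Finset.nonempty_iff_ne_empty.mpr h
      have h1 := DFunLike.congr_fun (mem_strictTableaux.mp hT).2 (T ⟨c, hc⟩)
      rw [content_apply, Finsupp.zero_apply, Finset.card_eq_zero] at h1
      exact Finset.notMem_empty (⟨c, hc⟩ : {c // c ∈ D}) (h1 ▸ by simp)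
  | cons a l ih =>
    intro D
    rw [levelCount]
    rw [Finset.card_eq_sum_card_fiberwise (f := unitCells)
      (t := (relMinimals cellRel D).powersetCard a)]
    · exact Finset.sum_congr rfl fun A hA => by 
        rw [card_filter_unitCells hA, ih]
        congr!
    · intro T hT
      obtain ⟨hT, hc⟩ := mem_strictTableaux.mp hT
      rw [strictRowsCols_iff] at hT
      rw [Finset.mem_coe, Finset.mem_powersetCard]
      constructor
      · intro c hc
        obtain ⟨hcD, h1⟩ := mem_unitCells.mp hc
        refine mem_relMinimals.mpr ⟨hcD, fun d hd hdc => ?_⟩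
        have := hT ⟨d, hd⟩ ⟨c, hcD⟩ hdc
        rw [h1] at this
        exact not_lt_one this
      · rw [unitCells, Finset.card_map, ← content_apply, hc, listContent_apply]
        rfl

theorem strictAdvExt_listContent {n m : ℕ} (α : Composition n) (β : Composition m) (l : List ℕ) :
    strictAdvExt α β (listContent l) = (levelCount cellRel l (skewDiagram α β) : ℚ) := by
  rw [← card_strictTableaux_listContent, strictTableaux, strictAdvExt,
    Set.ncard_eq_toFinset_card _ (finite_tableaux_content _ _)]

/-! ### Symmetric functions and exchange of blocks of variables -/

theorem monomialSymm_equivMapDomain {n : ℕ} (μ : Composition n) (σ : Equiv.Perm ℕ+)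
    (d : ℕ+ →₀ ℕ) : monomialSymm μ (d.equivMapDomain σ) = monomialSymm μ d := by
  have key : ∀ (σ : Equiv.Perm ℕ+) (d : ℕ+ →₀ ℕ),
      (∃ i : Fin μ.length ↪ ℕ+, d = ∑ j, Finsupp.single (i j) (μ.blocksFun j)) →
      ∃ i : Fin μ.length ↪ ℕ+,
        d.equivMapDomain σ = ∑ j, Finsupp.single (i j) (μ.blocksFun j) := by
    rintro σ d ⟨i, rfl⟩
    refine ⟨i.trans σ.toEmbedding, ?_⟩
    rw [Finsupp.equivMapDomain_eq_mapDomain, Finsupp.mapDomain_finsetSum]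
    exact Finset.sum_congr rfl fun j _ => Finsupp.mapDomain_single
  rw [monomialSymm, monomialSymm]
  congr 1
  refine propext ⟨fun h => ?_, key σ d⟩
  have h1 := key σ.symm _ h
  rwa [← Finsupp.equivMapDomain_trans, Equiv.self_trans_symm, Finsupp.equivMapDomain_refl] at h1

theorem coeff_equivMapDomain_of_mem_symFunctions {f : MvPowerSeries ℕ+ ℚ} (hf : f ∈ SymFunctions)
    (σ : Equiv.Perm ℕ+) (d : ℕ+ →₀ ℕ) : f (d.equivMapDomain σ) = f d := by
  induction hf using Submodule.span_induction with
  | mem f hf =>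
    obtain ⟨n, μ, _, rfl⟩ := hf
    exact monomialSymm_equivMapDomain μ σ d
  | zero => rfl
  | add f g _ _ hf hg => exact congrArg₂ (· + ·) hf hg
  | smul a f _ hf => exact congrArg (a * ·) hf

/-- The permutation of `ℕ` that exchanges the first `p` numbers with the next `q` ones. -/
def blockSwap (p q : ℕ) : Equiv.Perm ℕ where
  toFun i := if i < p then i + q else if i < p + q then i - p else i
  invFun i := if i < q then i + p else if i < p + q then i - q else i
  left_inv i := by grind
  right_inv i := by grind

theorem listContent_append_comm (β γ : List ℕ) :
    ∃ σ : Equiv.Perm ℕ+, listContent (γ ++ β) = (listContent (β ++ γ)).equivMapDomain σ := by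
  refine ⟨Equiv.pnatEquivNat.trans
    ((blockSwap β.length γ.length).trans Equiv.pnatEquivNat.symm), ?_⟩
  ext i
  rw [Finsupp.equivMapDomain_apply, listContent_apply, listContent_apply]
  have h : ((Equiv.pnatEquivNat.trans ((blockSwap β.length γ.length).trans
      Equiv.pnatEquivNat.symm)).symm i).natPred =
      (blockSwap β.length γ.length).symm i.natPred := by
    simp [Equiv.pnatEquivNat]
  rw [h]
  generalize i.natPred = k
  change _ = (β ++ γ).getD (if k < γ.length then k + β.length else
    if k < β.length + γ.length then k - γ.length else k) 0
  split_ifs with h1 h2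
  · rw [List.getD_append _ _ _ _ h1, List.getD_append_right _ _ _ _ (by omega)]
    simp
  · rw [List.getD_append_right _ _ _ _ (by omega), List.getD_append _ _ _ _ (by omega)]
  · rw [List.getD_eq_default _ _ (by simp; omega), List.getD_eq_default _ _ (by simp; omega)]

theorem levelCount_append_comm {n m : ℕ} {α : Composition n} {lam : Composition m}
    (h : strictAdvExt α lam ∈ SymFunctions) (β γ : List ℕ) :
    levelCount cellRel (β ++ γ) (skewDiagram α lam) =
      levelCount cellRel (γ ++ β) (skewDiagram α lam) := by
  obtain ⟨σ, hσ⟩ := listContent_append_comm β γ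
  have h1 := coeff_equivMapDomain_of_mem_symFunctions h σ (listContent (β ++ γ))
  rw [← hσ, strictAdvExt_listContent, strictAdvExt_listContent] at h1
  exact_mod_cast h1.symm

/-! ### Parts of compositions and the target shape -/

theorem partAt_eq_zero {n : ℕ} (α : Composition n) {i : ℕ} (h : α.length ≤ i) : partAt α i = 0 :=
  List.getD_eq_default _ _ h

theorem partAt_antitone {n : ℕ} {α : Composition n} (h : IsPartition α) {i j : ℕ} (hij : i ≤ j) :
    partAt α j ≤ partAt α i := by
  rcases hij.eq_or_lt with rfl | hij
  · exact le_rfl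
  by_cases hj : j < α.blocks.length
  · have := List.pairwise_iff_getElem.mp h i j (hij.trans hj) hj hij
    rw [partAt, partAt, List.getD_eq_getElem _ _ hj, List.getD_eq_getElem _ _ (hij.trans hj)]
    exact this
  · rw [partAt_eq_zero α (not_lt.mp hj)]
    exact Nat.zero_le _

theorem sum_range_partAt {n : ℕ} (α : Composition n) {L : ℕ} (h : α.length ≤ L) :
    ∑ i ∈ Finset.range L, partAt α i = n := by
  have h1 : ∑ i ∈ Finset.range α.length, partAt α i = n := by
    rw [Finset.sum_range]
    conv_rhs => rw [← α.sum_blocksFun]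
    exact Finset.sum_congr rfl fun i _ => List.getD_eq_getElem _ _ i.2
  rw [← Finset.sum_subset (Finset.range_mono h), h1]
  intro i _ hi
  exact partAt_eq_zero α (by simpa using hi)

theorem mem_compDiagram_onesThenRow {N k : ℕ} (hk : k < N) (i j : ℕ) :
    (i, j) ∈ compDiagram (onesThenRow N k hk) ↔ (i < k ∧ j = 0) ∨ (i = k ∧ j < N - k) := by
  rw [compDiagram, mem_skewDiagram]
  have h0 : partAt (Composition.ones 0) i = 0 := partAt_eq_zero _ (by simp)
  have h1 : partAt (onesThenRow N k hk) i = if i < k then 1 else if i = k then N - k else 0 := by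
    rw [partAt, onesThenRow]
    split_ifs with h1 h2
    · rw [List.getD_append _ _ _ _ (by simpa using h1)]
      simp [h1]
    · subst h2
      rw [List.getD_append_right _ _ _ _ (by simp)]
      simp
    · exact List.getD_eq_default _ _ (by simp; omega)
  rw [h0, h1]
  split_ifs <;> omega

theorem isCompShape_onesThenRow_iff {n m N k : ℕ} (α : Composition n) (β : Composition m)
    (hk : k < N) : IsCompShape α β (onesThenRow N k hk) ↔ ∃ s, ∀ i j, (i, j) ∈ skewDiagram α β ↔
      (i < k ∧ j = s) ∨ (i = k ∧ s ≤ j ∧ j < s + (N - k)) := by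
  have key : ∀ s i j, (i, j) ∈ (compDiagram (onesThenRow N k hk)).image (fun c => (c.1, c.2 + s)) ↔
      (i < k ∧ j = s) ∨ (i = k ∧ s ≤ j ∧ j < s + (N - k)) := by
    intro s i j
    rw [Finset.mem_image]
    constructor
    · rintro ⟨⟨i', j'⟩, h, heq⟩
      rw [mem_compDiagram_onesThenRow] at h
      simp only [Prod.mk.injEq] at heq
      omega
    · intro h
      refine ⟨(i, j - s), (mem_compDiagram_onesThenRow hk _ _).mpr (by omega), ?_⟩
      simp only [Prod.mk.injEq, true_and]
      omega
  refine exists_congr fun s => ⟨fun h i j => by rw [h, key], fun h => ?_⟩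
  ext ⟨i, j⟩
  rw [h, key]

/-! ### Symmetry forces the shape -/

theorem exists_isCompShape_of_mem_symFunctions {n m : ℕ} (α : Composition n) (lam : Composition m)
    (hlam : IsPartition lam) (hsub : CompContained lam α) (hne : (skewDiagram α lam).Nonempty)
    (hrow : EveryRowNonempty α lam) (hconn : DiagramConnected α lam)
    (hF : strictAdvExt α lam ∈ SymFunctions) :
    ∃ (k : ℕ) (hk : k < n - m), IsCompShape α lam (onesThenRow (n - m) k hk) := by
  classical
  have hsymm := levelCount_append_comm hF
  have hrl : ∀ i j, (i, j) ∈ skewDiagram α lam → i < α.length := by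
    intro i j h
    rw [mem_skewDiagram] at h
    by_contra hi
    rw [partAt_eq_zero α (not_lt.mp hi)] at h
    omega
  have hlt : ∀ i < α.length, partAt lam i < partAt α i := by
    intro i hi
    obtain ⟨j, hj⟩ := hrow i hi
    rw [mem_skewDiagram] at hj
    omega
  have hone : (relMinimals cellRel (skewDiagram α lam)).card = 1 := by
    -- A set `J` closed under comparability contains every row and column of the diagram that it
    -- meets. If proper, it would split the rows into those meeting `J` and the others, against
    -- `hconn`.
    refine card_relMinimals_eq_one cellRel_wellFounded hne hsymm fun J hJD hJne hJ => ?_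
    have hJrow : ∀ i j j', (i, j) ∈ J → (i, j') ∈ skewDiagram α lam → (i, j') ∈ J := by
      intro i j j' h h'
      rcases lt_trichotomy j j' with hj | rfl | hj
      · exact hJ _ h _ h' (Or.inl (Or.inr ⟨rfl, hj⟩))
      · exact h
      · exact hJ _ h _ h' (Or.inr (Or.inr ⟨rfl, hj⟩))
    have hJcol : ∀ i i' j, (i, j) ∈ J → (i', j) ∈ skewDiagram α lam → (i', j) ∈ J := by
      intro i i' j h h'
      rcases lt_trichotomy i i' with hi | rfl | hi
      · exact hJ _ h _ h' (Or.inl (Or.inl ⟨rfl, hi⟩))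
      · exact h
      · exact hJ _ h _ h' (Or.inr (Or.inl ⟨rfl, hi⟩))
    by_contra hJne'
    obtain ⟨⟨i₀, j₀⟩, hD₀, hJ₀⟩ := Finset.exists_of_ssubset (hJD.ssubset_of_ne hJne')
    obtain ⟨⟨i₁, j₁⟩, hJ₁⟩ := hJne
    refine hconn ⟨(Finset.range α.length).filter fun i => ∃ j, (i, j) ∈ J,
      (Finset.range α.length).filter fun i => ¬ ∃ j, (i, j) ∈ J, ?_, ?_,
      Finset.disjoint_filter_filter_not _ _ _, Finset.filter_union_filter_not_eq _ _, ?_⟩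
    · exact ⟨i₁, Finset.mem_filter.mpr ⟨Finset.mem_range.mpr (hrl _ _ (hJD hJ₁)), j₁, hJ₁⟩⟩
    · refine ⟨i₀, Finset.mem_filter.mpr ⟨Finset.mem_range.mpr (hrl _ _ hD₀), ?_⟩⟩
      rintro ⟨j, hj⟩
      exact hJ₀ (hJrow _ _ _ hj hD₀)
    · rintro i hi i' hi' j ⟨h, h'⟩
      obtain ⟨_, j', hj'⟩ := Finset.mem_filter.mp hi
      exact (Finset.mem_filter.mp hi').2 ⟨j, hJcol i i' j (hJrow _ _ _ hj' h) h'⟩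
  have hlow : ∀ I ⊆ skewDiagram α lam,
      (∀ c ∈ I, ∀ d ∈ skewDiagram α lam, cellRel d c → d ∈ I) → ∀ x y,
      x ∈ relMinimals cellRel (skewDiagram α lam \ I) →
      y ∈ relMinimals cellRel (skewDiagram α lam \ I) → x = y := by
    intro I hI hIl x y hx hy
    have h := card_relMinimals_sdiff_le cellRel_wellFounded hsymm hI hIl
    rw [hone] at h
    exact Finset.card_le_one.mp h x (by convert hx) y (by convert hy)
  obtain ⟨⟨i₁, j₁⟩, h₁⟩ := hne
  obtain ⟨k, hk⟩ : ∃ k, α.length = k + 1 := ⟨α.length - 1, by have := hrl _ _ h₁; omega⟩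
  set s := partAt lam 0 with hs
  -- In the first row `i` whose left edge differs from `s`, that edge lies left of all lower rows,
  -- so its first cell would be a second minimal cell beside `(0, s)`.
  have hlams : ∀ i < α.length, partAt lam i = s := by
    by_contra! hcon
    obtain ⟨hi, his⟩ := Nat.find_spec hcon
    have hmin := fun i' (h : i' < Nat.find hcon) => Nat.find_min hcon h
    set i := Nat.find hcon
    have hle : partAt lam i ≤ s := partAt_antitone hlam (Nat.zero_le i)
    have h0 : ((0, s) : ℕ × ℕ) ∈ relMinimals cellRel (skewDiagram α lam) := by
      refine mem_relMinimals.mpr ⟨(mem_skewDiagram _ _ _ _).mpr ⟨le_rfl, hlt 0 (by omega)⟩, ?_⟩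
      rintro ⟨a, b⟩ hab h
      rw [mem_skewDiagram] at hab
      rcases h with ⟨_, h⟩ | ⟨rfl, h⟩
      · exact absurd h (Nat.not_lt_zero _)
      · simp only at h hab
        omega
    have h1 : (i, partAt lam i) ∈ relMinimals cellRel (skewDiagram α lam) := by
      refine mem_relMinimals.mpr ⟨(mem_skewDiagram _ _ _ _).mpr ⟨le_rfl, hlt i hi⟩, ?_⟩
      rintro ⟨a, b⟩ hab h
      rw [mem_skewDiagram] at hab
      rcases h with ⟨h, h'⟩ | ⟨h, h'⟩ <;> simp only at h h'
      · have := hmin a h'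
        have ha : partAt lam a = s := by
          by_contra hne
          exact this ⟨by omega, hne⟩
        omega
      · subst h
        omega
    have h2 := Finset.card_le_one.mp hone.le _ h0 _ h1
    simp only [Prod.mk.injEq] at h2
    omega
  have hones : ∀ i < k, partAt α i = s + 1 := by
    intro i hi
    have hi1 := hlams i (by omega)
    have hi2 := hlams (i + 1) (by omega)
    have hi3 := hlt i (by omega)
    have hi4 := hlt (i + 1) (by omega)
    by_contra hcon
    -- If row `i` below the top had a second cell, removing the lower rows and `(i, s)` would leave
    -- both `(i, s + 1)` and `(i + 1, s)` minimal.
    have h2 := hlow ((skewDiagram α lam).filter fun c => c.1 < i ∨ (c.1 = i ∧ c.2 = s))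
      (Finset.filter_subset _ _) ?_ (i, s + 1) (i + 1, s) ?_ ?_
    · simp at h2
    · rintro ⟨a, b⟩ hc ⟨a', b'⟩ hd h
      simp only [Finset.mem_filter, mem_skewDiagram, cellRel] at hc hd h ⊢
      have h' := partAt_antitone hlam (i := a') (j := i)
      omega
    · simp only [mem_relMinimals, Finset.mem_sdiff, Finset.mem_filter, mem_skewDiagram, cellRel,
        Prod.forall]
      refine ⟨by omega, fun a b h h' => ?_⟩
      rcases h' with h' | ⟨rfl, h'⟩ <;> omega
    · simp only [mem_relMinimals, Finset.mem_sdiff, Finset.mem_filter, mem_skewDiagram, cellRel,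
        Prod.forall]
      refine ⟨by omega, fun a b h h' => ?_⟩
      rcases h' with h' | ⟨rfl, h'⟩ <;> omega
  -- The top row has `t + 1` cells; the sums of parts below identify `n - m` with `k + (t + 1)`.
  obtain ⟨t, ht⟩ : ∃ t, partAt α k = s + (t + 1) :=
    ⟨partAt α k - s - 1, by have := hlt k (by omega); have := hlams k (by omega); omega⟩
  have hn : n = k * (s + 1) + (s + (t + 1)) := by
    rw [← sum_range_partAt α le_rfl, hk, Finset.sum_range_succ, ht,
      Finset.sum_congr rfl fun i hi => hones i (Finset.mem_range.mp hi)]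
    simp
  have hm : m = (k + 1) * s := by
    rw [← sum_range_partAt lam hsub.1, hk,
      Finset.sum_congr rfl fun i hi => hlams i (hk ▸ Finset.mem_range.mp hi)]
    simp
  have hnm : n = m + (k + (t + 1)) := by
    rw [hn, hm]
    ring
  have hnm' : n - m = k + (t + 1) := by omega
  refine ⟨k, by omega, (isCompShape_onesThenRow_iff _ _ _).mpr ⟨s, fun i j => ?_⟩⟩
  rw [mem_skewDiagram, hnm']
  rcases lt_trichotomy i k with hi | rfl | hi
  · rw [hlams i (by omega), hones i hi]
    omega
  · rw [hlams i (by omega), ht]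
    omega
  · rw [partAt_eq_zero α (by omega)]
    omega

/-! ### The converse: a chain of cells gives an elementary symmetric function -/

theorem exists_embedding_ones_iff (N : ℕ) (d : ℕ+ →₀ ℕ) :
    (∃ i : Fin (Composition.ones N).length ↪ ℕ+,
      d = ∑ j, Finsupp.single (i j) ((Composition.ones N).blocksFun j)) ↔
    ∃ S : Finset ℕ+, S.card = N ∧ d = ∑ x ∈ S, Finsupp.single x 1 := by
  simp only [Composition.ones_blocksFun]
  constructor
  · rintro ⟨i, rfl⟩
    exact ⟨Finset.univ.map i, by simp, by rw [Finset.sum_map]⟩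
  · rintro ⟨S, hS, rfl⟩
    refine ⟨(S.orderEmbOfFin (hS.trans (Composition.ones_length N).symm)).toEmbedding, ?_⟩
    conv_lhs => rw [← Finset.map_orderEmbOfFin_univ S
      (hS.trans (Composition.ones_length N).symm)]
    rw [Finset.sum_map]

theorem strictAdvExt_mem_symFunctions {n m N k : ℕ} (α : Composition n) (lam : Composition m)
    (hk : k < N) (h : IsCompShape α lam (onesThenRow N k hk)) :
    strictAdvExt α lam ∈ SymFunctions := by
  classical
  obtain ⟨s, hs⟩ := (isCompShape_onesThenRow_iff _ _ _).mp h
  -- The chain runs up column `s` to row `k`, then right along that row; truncated subtraction keeps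
  -- `p - k` at 0 on the column.
  let e : Fin N ≃ {c : ℕ × ℕ // c ∈ skewDiagram α lam} :=
    { toFun := fun p => ⟨(min p k, s + (p - k)), by rw [hs]; omega⟩
      invFun := fun c => ⟨c.1.1 + (c.1.2 - s), by have := (hs c.1.1 c.1.2).mp c.2; omega⟩
      left_inv := fun p => Fin.ext (by simp only; omega)
      right_inv := fun c => by
        have := (hs c.1.1 c.1.2).mp c.2
        refine Subtype.ext (Prod.ext ?_ ?_) <;> simp only <;> omega }
  have hstrict : ∀ T : Tableau (skewDiagram α lam), StrictRowsCols T ↔ StrictMono (T ∘ e) := by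
    intro T
    rw [strictRowsCols_iff]
    constructor
    · intro hT p q hpq
      have hpq' : (p : ℕ) < q := hpq
      by_cases hq : (q : ℕ) ≤ k
      · exact hT _ _ (Or.inl (by simp only [e, Equiv.coe_fn_mk]; omega))
      by_cases hp : k ≤ (p : ℕ)
      · exact hT _ _ (Or.inr (by simp only [e, Equiv.coe_fn_mk]; omega))
      -- `cellRel` is not transitive, so the comparison passes through the corner cell.
      · exact (hT (e p) (e ⟨k, hk⟩) (Or.inl (by simp only [e, Equiv.coe_fn_mk]; omega))).trans
          (hT (e ⟨k, hk⟩) (e q) (Or.inr (by simp only [e, Equiv.coe_fn_mk]; omega)))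
    · intro hT c d hcd
      obtain ⟨p, rfl⟩ := e.surjective c
      obtain ⟨q, rfl⟩ := e.surjective d
      refine hT (show (p : ℕ) < q from ?_)
      simp only [cellRel, e, Equiv.coe_fn_mk] at hcd
      omega
  have hcontent : ∀ T : Tableau (skewDiagram α lam),
      content T = ∑ p, Finsupp.single ((T ∘ e) p) 1 := fun T =>
    (e.sum_comp fun c => Finsupp.single (T c) 1).symm
  have hF : strictAdvExt α lam = monomialSymm (Composition.ones N) := by
    funext d
    rw [strictAdvExt, monomialSymm]
    split_ifs with hd
    · obtain ⟨S, hS, rfl⟩ := (exists_embedding_ones_iff N d).mp hd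
      -- A strict filling of a chain lists its set of entries in increasing order, so `S` determines
      -- it.
      rw [show {T : Tableau (skewDiagram α lam) | StrictRowsCols T ∧
        content T = ∑ x ∈ S, Finsupp.single x 1} = {S.orderEmbOfFin hS ∘ e.symm} from ?_]
      · simp
      ext T
      rw [Set.mem_ofPred_eq, Set.mem_singleton_iff]
      constructor
      · rintro ⟨hT, hc⟩
        have hmem : ∀ p, (T ∘ e) p ∈ S := by
          intro p
          by_contra hp
          have h1 := DFunLike.congr_fun hc (T (e p))
          rw [content_apply, Finsupp.finsetSum_apply, Finset.sum_eq_zero, Finset.card_eq_zero] at h1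
          · exact Finset.notMem_empty (e p) (h1 ▸ by simp)
          · intro x hx
            refine Finsupp.single_eq_of_ne ?_
            rintro rfl
            exact hp hx
        rw [← Finset.orderEmbOfFin_unique hS hmem ((hstrict T).mp hT)]
        ext1 c
        simp
      · rintro rfl
        have h1 : (S.orderEmbOfFin hS ∘ e.symm) ∘ e = S.orderEmbOfFin hS := by
          ext1 p
          simp
        rw [hstrict, hcontent, h1]
        refine ⟨(S.orderEmbOfFin hS).strictMono, ?_⟩
        conv_rhs => rw [← Finset.map_orderEmbOfFin_univ S hS]
        rw [Finset.sum_map]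
        rfl
    · rw [show {T : Tableau (skewDiagram α lam) | StrictRowsCols T ∧ content T = d} = ∅ from ?_]
      · simp
      rw [Set.eq_empty_iff_forall_notMem]
      rintro T ⟨hT, hc⟩
      have hmono := (hstrict T).mp hT
      refine hd ((exists_embedding_ones_iff N d).mpr
        ⟨Finset.univ.map ⟨T ∘ e, hmono.injective⟩, by simp, ?_⟩)
      rw [← hc, hcontent, Finset.sum_map]
      rfl
  rw [hF]
  refine Submodule.subset_span ⟨N, Composition.ones N, ?_, rfl⟩
  rw [IsPartition, Composition.ones_blocks, List.pairwise_replicate]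
  exact Or.inr le_rfl

theorem theorem5p5 {n m : ℕ} (α : Composition n) (lam : Composition m)
    (hlam : IsPartition lam) (hsub : CompContained lam α)
    (hne : (skewDiagram α lam).Nonempty)
    (hrow : EveryRowNonempty α lam) (hconn : DiagramConnected α lam) :
    strictAdvExt α lam ∈ SymFunctions ↔
      ∃ (k : ℕ) (hk : k < n - m), IsCompShape α lam (onesThenRow (n - m) k hk) :=
  ⟨exists_isCompShape_of_mem_symFunctions α lam hlam hsub hne hrow hconn,
    fun ⟨_, hk, h⟩ => strictAdvExt_mem_symFunctions α lam hk h⟩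

end
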